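/- Let $d\ge 2$ and let $(M,g)$ be a connected, complete, smooth $d$-dimensional Riemannian manifold. Suppose that $M$ has a pole $o\in M$, that is, the exponential map $\exp_o\colon T_oM\to M$ is a diffeomorphism. Let $r(x)=\operatorname{dist}(x,o)$ and suppose that there is $\delta\in(0,1]$ such that $$\nabla^2 r^2\ \ge\ (1+\delta)\,g\qquad\text{on } M$$ as quadratic forms on the fibres of $TM$, where $\nabla^2$ is the geometric Hessian, $(\nabla^2 f)_{ij}=\partial_i\partial_j f-\Gamma^k_{ij}\partial_k f$ in local coordinates. For $t>0$ and $x\in M$ put $$\omega(t,x)=\exp_o\bigl[\tfrac1t\,\exp_o^{-1}(x)\bigr].$$ Then for every geodesic $x(t)$ of $(M,g)$ (a solution of $\ddot x^k+\Gamma^k_{ij}\dot x^i\dot x^j=0$, of any constant speed, defined for all sufficiently large $t$) the limit $$\omega_\infty=\lim_{t\to\infty}\omega(t,x(t))$$ exists in $M$. -/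

import Mathlib

open Set Filter Topology Manifold Bundle
open scoped ContDiff

noncomputable section

namespace PoleScattering

variable {d : ℕ} {M : Type*} [MetricSpace M] [ChartedSpace (EuclideanSpace ℝ (Fin d)) M]

/-- The `i`-th standard basis vector of `ℝ^d`. -/
def stdVec (d : ℕ) (i : Fin d) : EuclideanSpace ℝ (Fin d) := EuclideanSpace.single i 1

/-- The `i`-th partial derivative of a real function on `ℝ^d`. -/
def pderiv (i : Fin d) (F : EuclideanSpace ℝ (Fin d) → ℝ) (y : EuclideanSpace ℝ (Fin d)) : ℝ :=
  fderiv ℝ F y (stdVec d i)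

section Metric

variable [RiemannianBundle (fun x : M ↦ TangentSpace (𝓡 d) x)]

/-- The coordinate vector field `∂ᵢ` of the local coordinates `e`, at the point with
coordinates `y`. -/
def coordVec (e : OpenPartialHomeomorph M (EuclideanSpace ℝ (Fin d))) (i : Fin d)
    (y : EuclideanSpace ℝ (Fin d)) : TangentSpace (𝓡 d) (e.symm y) :=
  mfderiv (𝓡 d) (𝓡 d) e.symm y (stdVec d i)

/-- The matrix `g_{ij} = g(∂ᵢ, ∂ⱼ)` of the Riemannian metric in the local coordinates `e`. -/
def metricMatrix (e : OpenPartialHomeomorph M (EuclideanSpace ℝ (Fin d)))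
    (y : EuclideanSpace ℝ (Fin d)) : Matrix (Fin d) (Fin d) ℝ :=
  Matrix.of fun i j ↦ inner ℝ (coordVec e i y) (coordVec e j y)

/-- The Christoffel symbol
`Γ^k_{ij} = 2⁻¹ g^{kl} (∂ᵢ g_{lj} + ∂ⱼ g_{li} - ∂ₗ g_{ij})` of the Levi-Civita connection in the
local coordinates `e`. -/
def christoffel (e : OpenPartialHomeomorph M (EuclideanSpace ℝ (Fin d))) (k i j : Fin d)
    (y : EuclideanSpace ℝ (Fin d)) : ℝ :=
  2⁻¹ * ∑ l, (metricMatrix e y)⁻¹ k l *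
    (pderiv i (fun z ↦ metricMatrix e z l j) y + pderiv j (fun z ↦ metricMatrix e z l i) y
      - pderiv l (fun z ↦ metricMatrix e z i j) y)

/-- The components `(∇²f)_{ij} = ∂ᵢ∂ⱼ f - Γ^k_{ij} ∂ₖ f` of the geometric Hessian of `f : M → ℝ` in
the local coordinates `e`. -/
def hessian (e : OpenPartialHomeomorph M (EuclideanSpace ℝ (Fin d))) (f : M → ℝ) (i j : Fin d)
    (y : EuclideanSpace ℝ (Fin d)) : ℝ :=
  pderiv i (pderiv j (f ∘ e.symm)) y - ∑ k, christoffel e k i j y * pderiv k (f ∘ e.symm) y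

/-- The inequality `∇²f ≥ c g` of quadratic forms on all the tangent spaces of `M`, written out in
arbitrary smooth local coordinates. -/
def HessianGE (f : M → ℝ) (c : ℝ) : Prop :=
  ∀ e ∈ IsManifold.maximalAtlas (𝓡 d) ∞ M, ∀ y ∈ e.target, ∀ v : Fin d → ℝ,
    c * ∑ i, ∑ j, metricMatrix e y i j * v i * v j ≤ ∑ i, ∑ j, hessian e f i j y * v i * v j

/-- `γ` is a geodesic on the open set `s ⊆ ℝ` of times: it is `C²` there and, in arbitrary smooth
local coordinates, it solves `ẍ^k + Γ^k_{ij} ẋ^i ẋ^j = 0`. -/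
structure IsGeodesicOn (γ : ℝ → M) (s : Set ℝ) : Prop where
  contMDiffOn : ContMDiffOn 𝓘(ℝ, ℝ) (𝓡 d) 2 γ s
  equation : ∀ e ∈ IsManifold.maximalAtlas (𝓡 d) ∞ M, ∀ t ∈ s, γ t ∈ e.source → ∀ k : Fin d,
    deriv (deriv fun τ ↦ e (γ τ) k) t
      + ∑ i, ∑ j, christoffel e k i j (e (γ t))
          * deriv (fun τ ↦ e (γ τ) i) t * deriv (fun τ ↦ e (γ τ) j) t = 0

/-- `γ : ℝ → M` is the geodesic with `γ(0) = o` and `γ'(0) = v`. -/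
def IsGeodesicFrom (o : M) (v : TangentSpace (𝓡 d) o) (γ : ℝ → M) : Prop :=
  IsGeodesicOn (d := d) γ univ ∧
    tangentMap 𝓘(ℝ, ℝ) (𝓡 d) γ ⟨(0 : ℝ), (1 : ℝ)⟩ = (⟨o, v⟩ : TangentBundle (𝓡 d) M)

open Classical in
/-- The exponential map `exp_o : T_oM → M`, `v ↦ γ_v(1)`, where `γ_v : ℝ → M` is the geodesic with
`γ_v(0) = o` and `γ_v'(0) = v` (on a complete manifold it always exists; the default value `o` is
never used there). -/
def expMap (o : M) (v : TangentSpace (𝓡 d) o) : M :=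
  if h : ∃ γ : ℝ → M, IsGeodesicFrom o v γ then h.choose 1 else o

/-- `o` is a pole of `M`: the exponential map `exp_o : T_oM → M` is a (smooth) diffeomorphism. -/
def IsPole (o : M) : Prop :=
  ∃ Φ : Diffeomorph 𝓘(ℝ, TangentSpace (𝓡 d) o) (𝓡 d) (TangentSpace (𝓡 d) o) M ∞,
    ∀ v, Φ v = expMap o v

/-- The geodesic dilation `ω(t, x) = exp_o (t⁻¹ exp_o⁻¹(x))` with respect to a pole `o`. -/
def dilation (d : ℕ) {M : Type*} [MetricSpace M] [ChartedSpace (EuclideanSpace ℝ (Fin d)) M]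
    [RiemannianBundle (fun x : M ↦ TangentSpace (𝓡 d) x)] (o : M) (t : ℝ) (x : M) : M :=
  expMap (d := d) o (t⁻¹ • Function.invFun (expMap (d := d) o) x)

end Metric

end PoleScattering

end

/-!
The proof takes place in normal coordinates. Composing `exp_o⁻¹` with an isometry `T_oM ≃ ℝ^d`
gives a global chart `e` of `M` with `e o = 0`, in which `ω(t, x)` is `e⁻¹ (t⁻¹ • e x)`. So the
claim is that the coordinates `x(t) ∈ ℝ^d` of a geodesic have an asymptotic velocity
`lim x(t) / t`.

Since geodesics are unique (`geodesic_unique`), the ones issuing from `o` are the lines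
`s ↦ s • v` in this chart (`IsNormalChart.exists_geodesic`). This gives the Gauss lemma
`g_y(y, u) = ⟪y, u⟫` (`IsNormalMetric.gauss`), and with it two facts.
* The distance to `o` is the Euclidean norm (`IsNormalChart.dist_eq_norm`), as the metric
  dominates the square of the radial velocity of any curve.
* The Hessian of `‖y‖²` is `2 g_y + D_y g_y`, where `D_y` is the derivative in the direction of
  `y` (`IsNormalMetric.hessian_norm_sq`). The convexity hypothesis therefore says that
  `D_y g_y ≥ (δ - 1) g_y`.

The last inequality is used in two ways. Along rays it makes `s ^ (1 - δ) * g_{s y}`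
nondecreasing, so that `‖w‖² ≤ C ‖y‖ ^ (1 - δ) g_y(w, w)` for `‖y‖ ≥ 1`
(`IsNormalMetric.exists_norm_sq_le`). Along a geodesic of speed `c > 0`, write `r = ‖x‖`, let `w`
be the part of the velocity which is orthogonal to `x`, and `q = g(w, w) = c² - r'²`. The function
`r²` is uniformly convex, hence `r` grows linearly; and `r'' ≥ (1 + δ) q / (2 r)` shows that
`q r ^ (1 + δ)` is nonincreasing. So `c - r' = O(t ^ -(1 + δ))`, and `(x / r)' = w / r` has norm
`O(r⁻¹ r ^ ((1 - δ) / 2) r ^ (-(1 + δ) / 2)) = O(t ^ -(1 + δ))`. Both are integrable, so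
`r / t → c` and the direction `x / r` converges (`IsNormalMetric.exists_tendsto_of_escaping`).
-/

namespace PoleScattering

/-! ### Metrics in normal coordinates and the Gauss lemma -/

/-- The chain rule along a curve. The target is an abstract normed space so that it also applies to
fields of bilinear forms without unfolding the structure of the space of such forms. -/
lemma _root_.ContDiff.hasDerivAt_comp {E F : Type*} [NormedAddCommGroup E] [NormedSpace ℝ E]
    [NormedAddCommGroup F] [NormedSpace ℝ F] {f : E → F} (hf : ContDiff ℝ 1 f) {x : ℝ → E} {x' : E}
    {t : ℝ} (hx : HasDerivAt x x' t) :
    HasDerivAt (fun s ↦ f (x s)) (fderiv ℝ f (x t) x') t :=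
  (hf.differentiable one_ne_zero (x t)).hasFDerivAt.comp_hasDerivAt t hx

section NormalCoordinates

set_option synthInstance.maxHeartbeats 200000

variable {E : Type*} [NormedAddCommGroup E] [InnerProductSpace ℝ E]

/-- A Riemannian metric `g` on a vector space `E`, together with its Christoffel symbols in the
form of the quadratic map `Γ y v = Γ_y(v, v)`. The Koszul formula, with one index lowered,
characterises `Γ`; a geodesic is a solution of `x'' = -Γ x x'`. -/
structure IsMetricWithChristoffel (g : E → E →L[ℝ] E →L[ℝ] ℝ) (Γ : E → E → E) : Prop where
  contDiff : ContDiff ℝ 1 g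
  symm : ∀ y u w, g y u w = g y w u
  pos : ∀ y u, u ≠ 0 → 0 < g y u u
  koszul : ∀ y v u, g y (Γ y v) u = fderiv ℝ g y v v u - 2⁻¹ * fderiv ℝ g y u v v

/-- The coordinates of `E` are normal coordinates centred at `0` for the metric `g`: the metric at
the origin is the scalar product of `E`, and the lines through the origin are geodesics. -/
structure IsNormalMetric (g : E → E →L[ℝ] E →L[ℝ] ℝ) (Γ : E → E → E) : Prop
    extends IsMetricWithChristoffel g Γ where
  apply_zero : ∀ u, g 0 u u = ‖u‖ ^ 2
  christoffel_line : ∀ (s : ℝ) (v : E), Γ (s • v) v = 0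

variable {g : E → E →L[ℝ] E →L[ℝ] ℝ} {Γ : E → E → E}

namespace IsMetricWithChristoffel

lemma nonneg (h : IsMetricWithChristoffel g Γ) (y u : E) : 0 ≤ g y u u := by
  rcases eq_or_ne u 0 with rfl | hu
  · rw [map_zero]
  · exact (h.pos y u hu).le

lemma hasDerivAt_apply (h : IsMetricWithChristoffel g Γ) {x a b : ℝ → E} {x' a' b' : E} {t : ℝ}
    (hx : HasDerivAt x x' t) (ha : HasDerivAt a a' t) (hb : HasDerivAt b b' t) :
    HasDerivAt (fun s ↦ g (x s) (a s) (b s))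
      (fderiv ℝ g (x t) x' (a t) (b t) + g (x t) a' (b t) + g (x t) (a t) b') t := by
  have h1 : HasDerivAt (fun s ↦ g (x s)) (fderiv ℝ g (x t) x') t := h.contDiff.hasDerivAt_comp hx
  have h2 := (h1.clm_apply ha).clm_apply hb
  rwa [add_apply] at h2

lemma fderiv_symm (h : IsMetricWithChristoffel g Γ) (y w u v : E) :
    fderiv ℝ g y w u v = fderiv ℝ g y w v u := by
  have hline : HasDerivAt (fun s : ℝ ↦ y + s • w) w 0 := by
    simpa using ((hasDerivAt_id (0 : ℝ)).smul_const w).const_add y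
  have h1 := h.hasDerivAt_apply hline (hasDerivAt_const 0 u) (hasDerivAt_const 0 v)
  have h2 := h.hasDerivAt_apply hline (hasDerivAt_const 0 v) (hasDerivAt_const 0 u)
  simp only [h.symm _ u v] at h1
  simpa using h1.unique h2

/-- Conservation of the speed of a geodesic. -/
lemma hasDerivAt_speed (h : IsMetricWithChristoffel g Γ) {x v : ℝ → E} {t : ℝ}
    (hx : HasDerivAt x (v t) t) (hv : HasDerivAt v (-Γ (x t) (v t)) t) :
    HasDerivAt (fun s ↦ g (x s) (v s) (v s)) 0 t := by
  convert! h.hasDerivAt_apply hx hv hv using 1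
  rw [h.symm _ (v t) (-_)]
  simp only [map_neg, neg_apply, h.koszul]
  ring

end IsMetricWithChristoffel

namespace IsNormalMetric

lemma apply_zero_eq_inner (h : IsNormalMetric g Γ) (u w : E) : g 0 u w = inner ℝ u w := by
  have h1 := h.apply_zero (u + w)
  rw [norm_add_sq_real] at h1
  simp only [map_add, add_apply, h.apply_zero, h.symm 0 w u] at h1
  linarith

lemma fderiv_line (h : IsNormalMetric g Γ) (s : ℝ) (v u : E) :
    fderiv ℝ g (s • v) v v u = 2⁻¹ * fderiv ℝ g (s • v) u v v := by
  have := h.koszul (s • v) v u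
  rw [h.christoffel_line] at this
  simp only [map_zero, zero_apply] at this
  linarith

lemma apply_line (h : IsNormalMetric g Γ) (s : ℝ) (y : E) : g (s • y) y y = ‖y‖ ^ 2 := by
  have hd : ∀ s : ℝ, HasDerivAt (fun s : ℝ ↦ g (s • y) y y) 0 s := fun s ↦ by
    have hline : HasDerivAt (fun s : ℝ ↦ s • y) y s := by
      simpa using (hasDerivAt_id s).smul_const y
    convert! h.hasDerivAt_apply hline (hasDerivAt_const s y) (hasDerivAt_const s y) using 1
    have := h.fderiv_line s y y
    simp only [map_zero, zero_apply]
    linarith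
  have := is_const_of_deriv_eq_zero (fun s ↦ (hd s).differentiableAt) (fun s ↦ (hd s).deriv) s 0
  simpa [h.apply_zero] using this

lemma apply_self_self (h : IsNormalMetric g Γ) (y : E) : g y y y = ‖y‖ ^ 2 := by
  simpa using h.apply_line 1 y

/-- The **Gauss lemma**: the metric and the flat scalar product agree on pairs containing a radial
vector. -/
lemma gauss (h : IsNormalMetric g Γ) (y u : E) : g y y u = inner ℝ y u := by
  have hrad : ∀ z : E, fderiv ℝ g z u z z + 2 * g z z u = 2 * inner ℝ z u := fun z ↦ by
    have hline : HasDerivAt (fun s : ℝ ↦ z + s • u) u 0 := by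
      simpa using ((hasDerivAt_id (0 : ℝ)).smul_const u).const_add z
    have h1 := h.hasDerivAt_apply hline hline hline
    have h2 := hline.norm_sq
    simp only [h.apply_self_self] at h1
    have := h1.unique h2
    simp only [zero_smul, add_zero, h.symm z u z] at this
    linarith
  -- `s ↦ s * g (s • y) y u` has the constant derivative `⟪y, u⟫`
  have hd : ∀ s : ℝ, HasDerivAt (fun s : ℝ ↦ s * g (s • y) y u - s * inner ℝ y u) 0 s := by
    intro s
    have hline : HasDerivAt (fun s : ℝ ↦ s • y) y s := by
      simpa using (hasDerivAt_id s).smul_const y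
    have h1 := h.hasDerivAt_apply hline (hasDerivAt_const s y) (hasDerivAt_const s u)
    have h2 := ((hasDerivAt_id s).mul h1).sub ((hasDerivAt_id s).mul_const (inner ℝ y u))
    convert! h2 using 1
    simp only [map_zero, zero_apply, id, h.fderiv_line, add_zero]
    rcases eq_or_ne s 0 with rfl | hs
    · simp [h.apply_zero_eq_inner]
    · have h3 := hrad (s • y)
      simp only [map_smul, smul_apply, smul_eq_mul, inner_smul_left,
        conj_trivial] at h3
      have h4 : s * (s * fderiv ℝ g (s • y) u y y + 2 * g (s • y) y u - 2 * inner ℝ y u) = 0 := by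
        linear_combination h3
      rcases mul_eq_zero.1 h4 with h5 | h5
      · exact absurd h5 hs
      · linear_combination -2⁻¹ * h5
  have := is_const_of_deriv_eq_zero (fun s ↦ (hd s).differentiableAt) (fun s ↦ (hd s).deriv) 1 0
  simp only [one_smul, one_mul, zero_mul, sub_zero] at this
  linarith

/-- The derivative of the Gauss lemma in the direction `w`. -/
lemma fderiv_apply_self (h : IsNormalMetric g Γ) (y w u : E) :
    fderiv ℝ g y w y u + g y w u = inner ℝ w u := by
  have hline : HasDerivAt (fun s : ℝ ↦ y + s • w) w 0 := by
    simpa using ((hasDerivAt_id (0 : ℝ)).smul_const w).const_add y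
  have h1 := h.hasDerivAt_apply hline hline (hasDerivAt_const 0 u)
  simp only [h.gauss] at h1
  have h2 := hline.inner ℝ (hasDerivAt_const (0 : ℝ) u)
  simpa using h1.unique h2

/-- The Hessian of `‖y‖²`, evaluated on a vector `w`, in terms of the radial derivative of the
metric. -/
lemma hessian_norm_sq (h : IsNormalMetric g Γ) (y w : E) :
    2 * ‖w‖ ^ 2 - 2 * inner ℝ y (Γ y w) = 2 * g y w w + fderiv ℝ g y y w w := by
  have h1 := h.fderiv_apply_self y w w
  rw [real_inner_self_eq_norm_sq, h.fderiv_symm] at h1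
  rw [← h.gauss, h.symm, h.koszul]
  linarith

/-- The radial derivative of the metric annihilates the pairs containing a radial vector. -/
lemma fderiv_radial (h : IsNormalMetric g Γ) (y u : E) : fderiv ℝ g y y y u = 0 := by
  have := h.fderiv_apply_self y y u
  rw [h.gauss] at this
  linarith

/-- Euclidean vectors are controlled by the norm of the metric: if the radial derivative of the
metric is at least `(δ - 1) g`, then `s ^ (1 - δ) * g (s • y)` is nondecreasing along rays, and it
is bounded below on the unit sphere by compactness. -/
lemma exists_norm_sq_le [FiniteDimensional ℝ E] (h : IsNormalMetric g Γ) {δ : ℝ}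
    (hδ : ∀ y w, (δ - 1) * g y w w ≤ fderiv ℝ g y y w w) :
    ∃ C, 0 < C ∧ ∀ y w, 1 ≤ ‖y‖ → ‖w‖ ^ 2 ≤ C * ‖y‖ ^ (1 - δ) * g y w w := by
  obtain ⟨m, hm, hmin⟩ : ∃ m, 0 < m ∧ ∀ e w : E, ‖e‖ = 1 → m * ‖w‖ ^ 2 ≤ g e w w := by
    have hK : IsCompact (Metric.sphere (0 : E) 1 ×ˢ Metric.sphere (0 : E) 1) :=
      (isCompact_sphere 0 1).prod (isCompact_sphere 0 1)
    have hc : Continuous fun p : E × E ↦ g p.1 p.2 p.2 :=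
      ((h.contDiff.continuous.comp continuous_fst).clm_apply continuous_snd).clm_apply
        continuous_snd
    obtain ⟨m, hm, hmin⟩ : ∃ m, 0 < m ∧ ∀ e u : E, ‖e‖ = 1 → ‖u‖ = 1 → m ≤ g e u u := by
      rcases (Metric.sphere (0 : E) 1 ×ˢ Metric.sphere (0 : E) 1).eq_empty_or_nonempty with h0 | h0
      -- the sphere is empty when `E` is trivial
      · refine ⟨1, one_pos, fun e u he hu ↦ ?_⟩
        have : (e, u) ∈ Metric.sphere (0 : E) 1 ×ˢ Metric.sphere (0 : E) 1 := by simp [he, hu]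
        simp [h0] at this
      · obtain ⟨p, hp, hpm⟩ := hK.exists_isMinOn h0 hc.continuousOn
        refine ⟨g p.1 p.2 p.2, h.pos _ _ ?_, fun e u he hu ↦ ?_⟩
        · rintro h2
          simp [h2] at hp
        · exact hpm (show (e, u) ∈ _ by simp [he, hu])
    refine ⟨m, hm, fun e w he ↦ ?_⟩
    rcases eq_or_ne w 0 with rfl | hw
    · simp
    · have hw' : 0 < ‖w‖ := norm_pos_iff.2 hw
      have := hmin e (‖w‖⁻¹ • w) he (by simp [norm_smul, hw'.ne'])
      simp only [map_smul, smul_apply, smul_eq_mul] at this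
      have h2 : m * ‖w‖ ^ 2 ≤ (‖w‖⁻¹ * (‖w‖⁻¹ * g e w w)) * ‖w‖ ^ 2 := by gcongr
      refine h2.trans_eq ?_
      field_simp
  refine ⟨m⁻¹, inv_pos.2 hm, fun y w hy ↦ ?_⟩
  have hy0 : 0 < ‖y‖ := one_pos.trans_le hy
  set e : E := ‖y‖⁻¹ • y with he
  have hd : ∀ s ∈ Icc 1 ‖y‖, HasDerivAt (fun s : ℝ ↦ s ^ (1 - δ) * g (s • e) w w)
      (s ^ (1 - δ - 1) * ((1 - δ) * g (s • e) w w + fderiv ℝ g (s • e) (s • e) w w)) s := by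
    intro s hs
    have hs0 : 0 < s := one_pos.trans_le hs.1
    have hline : HasDerivAt (fun s : ℝ ↦ s • e) e s := by
      simpa using (hasDerivAt_id s).smul_const e
    have h1 := h.hasDerivAt_apply hline (hasDerivAt_const s w) (hasDerivAt_const s w)
    have h2 := ((hasDerivAt_id s).rpow_const (p := 1 - δ) (Or.inl hs0.ne')).mul h1
    convert! h2 using 1
    have h3 : s ^ (1 - δ) = s ^ (1 - δ - 1) * s := by
      rw [← Real.rpow_add_one hs0.ne']; congr 1; ring
    simp only [map_zero, zero_apply, id, add_zero, map_smul,
      smul_apply, smul_eq_mul, h3]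
    ring
  have hmono := monotoneOn_of_hasDerivWithinAt_nonneg (convex_Icc 1 ‖y‖)
    (fun s hs ↦ (hd s hs).continuousAt.continuousWithinAt)
    (fun s hs ↦ (hd s (interior_subset hs)).hasDerivWithinAt)
    (fun s hs ↦ mul_nonneg (Real.rpow_nonneg (by linarith [(interior_subset hs).1]) _)
      (by linarith [hδ (s • e) w]))
  have h1 := hmono (left_mem_Icc.2 hy) (right_mem_Icc.2 hy) hy
  have h2 : ‖y‖ • e = y := by rw [he, smul_smul, mul_inv_cancel₀ hy0.ne', one_smul]
  simp only [Real.one_rpow, one_smul, one_mul, h2] at h1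
  have h3 := hmin e w (by simp [he, norm_smul, hy0.ne'])
  rw [mul_assoc, inv_mul_eq_div, le_div_iff₀ hm]
  linarith

end IsNormalMetric

/-- Geodesics are determined by their initial position and velocity. -/
lemma geodesic_unique [FiniteDimensional ℝ E] (hΓ : ContDiff ℝ 1 fun p : E × E ↦ Γ p.1 p.2)
    {x v y w : ℝ → E} (hx : ∀ t, HasDerivAt x (v t) t)
    (hv : ∀ t, HasDerivAt v (-Γ (x t) (v t)) t) (hy : ∀ t, HasDerivAt y (w t) t)
    (hw : ∀ t, HasDerivAt w (-Γ (y t) (w t)) t) (h0 : x 0 = y 0) (h0' : v 0 = w 0) : x = y := by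
  have hF : ContDiff ℝ 1 fun p : E × E ↦ (p.2, -Γ p.1 p.2) := contDiff_snd.prodMk hΓ.neg
  have hf : ∀ t, HasDerivAt (fun t ↦ (x t, v t)) (v t, -Γ (x t) (v t)) t :=
    fun t ↦ (hx t).prodMk (hv t)
  have hg : ∀ t, HasDerivAt (fun t ↦ (y t, w t)) (w t, -Γ (y t) (w t)) t :=
    fun t ↦ (hy t).prodMk (hw t)
  ext t
  set R := |t| + 1
  have hc : IsCompact ((fun t ↦ (x t, v t)) '' Icc (-R) R ∪ (fun t ↦ (y t, w t)) '' Icc (-R) R) :=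
    (isCompact_Icc.image_of_continuousOn
      fun s _ ↦ (hf s).continuousAt.continuousWithinAt).union
    (isCompact_Icc.image_of_continuousOn fun s _ ↦ (hg s).continuousAt.continuousWithinAt)
  obtain ⟨K, hK⟩ := hF.locallyLipschitz.locallyLipschitzOn.exists_lipschitzOnWith_of_compact hc
  have ht := abs_le.1 (le_refl |t|)
  have ht0 := abs_nonneg t
  have := ODE_solution_unique_of_mem_Ioo (v := fun _ p ↦ ((p.2, -Γ p.1 p.2) : E × E))
    (a := -R) (b := R) (t₀ := 0) (fun _ _ ↦ hK) (by constructor <;> linarith)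
    (fun s hs ↦ ⟨hf s, Or.inl ⟨s, Ioo_subset_Icc_self hs, rfl⟩⟩)
    (fun s hs ↦ ⟨hg s, Or.inr ⟨s, Ioo_subset_Icc_self hs, rfl⟩⟩) (by simp [h0, h0'])
    (show t ∈ Ioo (-R) R by constructor <;> linarith)
  exact (Prod.ext_iff.1 this).1

end NormalCoordinates

/-! ### Asymptotics of geodesics in normal coordinates -/

section Asymptotics

open MeasureTheory

set_option synthInstance.maxHeartbeats 200000

lemma eq_of_hasDerivAt_zero {F : Type*} [NormedAddCommGroup F] [NormedSpace ℝ F] {f : ℝ → F} {T : ℝ}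
    (hf : ∀ t > T, HasDerivAt f 0 t) : ∀ t > T, f t = f (T + 1) := fun _ ht ↦
  isOpen_Ioi.is_const_of_deriv_eq_zero isPreconnected_Ioi
    (fun s hs ↦ (hf s hs).differentiableAt.differentiableWithinAt) (fun s hs ↦ (hf s hs).deriv)
    ht (lt_add_one T)

lemma exists_le_of_hasDerivAt_nonneg {f f' : ℝ → ℝ} {T : ℝ}
    (hf : ∀ t > T, HasDerivAt f (f' t) t) (hf' : ∀ t > T, 0 ≤ f' t) :
    ∃ C, ∀ t, T + 1 ≤ t → C ≤ f t := by
  have hT : ∀ t ∈ Ici (T + 1), T < t := fun t ht ↦ (lt_add_one T).trans_le ht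
  have := monotoneOn_of_hasDerivWithinAt_nonneg (convex_Ici (T + 1))
    (fun t ht ↦ (hf t (hT t ht)).continuousAt.continuousWithinAt)
    (fun t ht ↦ (hf t (hT t (interior_subset ht))).hasDerivWithinAt)
    (fun t ht ↦ hf' t (hT t (interior_subset ht)))
  exact ⟨f (T + 1), fun t ht ↦ this self_mem_Ici ht ht⟩

/-- A function whose second derivative is bounded below by a positive constant grows
quadratically. -/
lemma eventually_quadratic_growth {f f' f'' : ℝ → ℝ} {T k : ℝ} (hk : 0 < k)
    (hf : ∀ t > T, HasDerivAt f (f' t) t) (hf' : ∀ t > T, HasDerivAt f' (f'' t) t)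
    (hf'' : ∀ t > T, 2 * k ≤ f'' t) :
    ∀ᶠ t in atTop, 0 < f' t ∧ k / 4 * t ^ 2 ≤ f t := by
  obtain ⟨C, hC⟩ := exists_le_of_hasDerivAt_nonneg (f := fun t ↦ f' t - 2 * k * t)
    (fun t ht ↦ (hf' t ht).sub ((hasDerivAt_id t).const_mul (2 * k)))
    (fun t ht ↦ by linarith [hf'' t ht])
  obtain ⟨t₁, ht₁T, ht₁⟩ : ∃ t₁, T ≤ t₁ ∧ ∀ t > t₁, k * t ≤ f' t := by
    refine ⟨max (T + 1) (-C / k), by linarith [le_max_left (T + 1) (-C / k)], fun t ht ↦ ?_⟩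
    have h1 := hC t ((le_max_left _ _).trans ht.le)
    have h2 : -C ≤ t * k := (div_le_iff₀ hk).1 ((le_max_right _ _).trans ht.le)
    linarith
  obtain ⟨D, hD⟩ := exists_le_of_hasDerivAt_nonneg (f := fun t ↦ f t - k / 2 * t ^ 2)
    (T := t₁) (fun t ht ↦ (hf t (ht₁T.trans_lt ht)).sub ((hasDerivAt_pow 2 t).const_mul (k / 2)))
    (fun t ht ↦ by have := ht₁ t ht; simp; linarith)
  filter_upwards [eventually_gt_atTop t₁, eventually_ge_atTop (t₁ + 1), eventually_ge_atTop 1,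
    eventually_ge_atTop (-D * 4 / k)] with t h1 h2 h3 h4
  have h5 := hD t h2
  rw [div_le_iff₀ hk] at h4
  refine ⟨(mul_pos hk (by linarith)).trans_le (ht₁ t h1), ?_⟩
  have h6 : t * k ≤ t ^ 2 * k := by gcongr; exact le_self_pow₀ h3 two_ne_zero
  linarith

lemma exists_tendsto_of_hasDerivAt_norm_le {F : Type*} [NormedAddCommGroup F] [NormedSpace ℝ F]
    [FiniteDimensional ℝ F] {f f' : ℝ → F} {T B δ : ℝ} (hT : 0 < T) (hδ : 0 < δ)
    (hf : ∀ t > T, HasDerivAt f (f' t) t) (hf' : ∀ t > T, ‖f' t‖ ≤ B * t ^ (-(1 + δ))) :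
    ∃ z, Tendsto f atTop (𝓝 z) := by
  have := FiniteDimensional.complete ℝ F
  have hd : ∀ t ∈ Ioi T, HasDerivAt f (deriv f t) t := fun t ht ↦
    (hf t ht).differentiableAt.hasDerivAt
  refine ⟨_, tendsto_limUnder_of_hasDerivAt_of_integrableOn_Ioi hd ?_⟩
  refine Integrable.mono' ((integrableOn_Ioi_rpow_of_lt (a := -(1 + δ)) (by linarith) hT).const_mul
    B) (aestronglyMeasurable_deriv f _) ?_
  refine (ae_restrict_iff' measurableSet_Ioi).2 (ae_of_all _ fun t ht ↦ ?_)
  rw [(hf t ht).deriv]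
  exact hf' t ht

variable {E : Type*} [NormedAddCommGroup E] [InnerProductSpace ℝ E] [FiniteDimensional ℝ E]
  {g : E → E →L[ℝ] E →L[ℝ] ℝ} {Γ : E → E → E}

/-- The heart of the matter: under the convexity of `‖y‖²`, a geodesic which moves away linearly
from the origin has an asymptotic velocity. -/
lemma IsNormalMetric.exists_tendsto_of_escaping (h : IsNormalMetric g Γ) {δ : ℝ}
    (hδ₀ : 0 < δ) (hδ : ∀ y w, (δ - 1) * g y w w ≤ fderiv ℝ g y y w w)
    {x v : ℝ → E} {T a c : ℝ} (hT : 0 < T) (ha : 0 < a) (hc : 0 < c)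
    (hx : ∀ t > T, HasDerivAt x (v t) t)
    (hv : ∀ t > T, HasDerivAt v (-Γ (x t) (v t)) t) (hspeed : ∀ t > T, g (x t) (v t) (v t) = c ^ 2)
    (hρ : ∀ t > T, 0 < (inner ℝ (x t) (v t) : ℝ)) (hr1 : ∀ t > T, 1 ≤ ‖x t‖)
    (hra : ∀ t > T, a * t ≤ ‖x t‖) :
    ∃ z, Tendsto (fun t ↦ t⁻¹ • x t) atTop (𝓝 z) := by
  set r : ℝ → ℝ := fun t ↦ ‖x t‖ with hr
  set ρ : ℝ → ℝ := fun t ↦ inner ℝ (x t) (v t) with hρdef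
  -- the radial velocity `p`, the tangential velocity `w`, and the tangential energy `q`
  set p : ℝ → ℝ := fun t ↦ ρ t / r t with hp
  set w : ℝ → E := fun t ↦ v t - (p t / r t) • x t with hw
  set q : ℝ → ℝ := fun t ↦ c ^ 2 - p t ^ 2 with hq
  have hr0 : ∀ t > T, 0 < r t := fun t ht ↦ one_pos.trans_le (hr1 t ht)
  have hp0 : ∀ t > T, 0 < p t := fun t ht ↦ div_pos (hρ t ht) (hr0 t ht)
  have hpr : ∀ t > T, ρ t = p t * r t := fun t ht ↦ by
    simp only [hp]; field_simp [(hr0 t ht).ne']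
  have hqw : ∀ t > T, g (x t) (w t) (w t) = q t := fun t ht ↦ by
    have h1 := hpr t ht
    have h2 : g (x t) (x t) (x t) = r t ^ 2 := h.apply_self_self _
    have h3 : g (x t) (x t) (v t) = ρ t := h.gauss _ _
    have := (hr0 t ht).ne'
    simp only [hw, map_sub, sub_apply, map_smul, smul_apply, smul_eq_mul, h.symm _ (v t) (x t),
      hspeed t ht, h2, h3, h1, hq]
    field_simp
    ring
  have hq0 : ∀ t > T, 0 ≤ q t := fun t ht ↦ hqw t ht ▸ h.nonneg _ _
  have hrd : ∀ t > T, HasDerivAt r (p t) t := fun t ht ↦ by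
    have h1 := ((hx t ht).norm_sq).sqrt (by have := hr0 t ht; positivity)
    simp only [Real.sqrt_sq (norm_nonneg _)] at h1
    convert! h1 using 1
    simp only [hp, hρdef, hr]
    field_simp
  have hρd : ∀ t > T, HasDerivAt ρ
      (c ^ 2 + 2⁻¹ * fderiv ℝ g (x t) (x t) (w t) (w t)) t := fun t ht ↦ by
    convert! (hx t ht).inner ℝ (hv t ht) using 1
    have h1 := h.hessian_norm_sq (x t) (v t)
    have h2 : fderiv ℝ g (x t) (x t) (w t) (w t) = fderiv ℝ g (x t) (x t) (v t) (v t) := by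
      simp only [hw, map_sub, sub_apply, map_smul, smul_apply, smul_eq_mul, h.fderiv_radial,
        h.fderiv_symm _ _ (v t) (x t)]
      ring
    rw [h2, real_inner_self_eq_norm_sq, inner_neg_right]
    rw [hspeed t ht] at h1
    linarith
  have hpd : ∀ t > T, HasDerivAt p
      ((q t + 2⁻¹ * fderiv ℝ g (x t) (x t) (w t) (w t)) / r t) t := fun t ht ↦ by
    have := (hr0 t ht).ne'
    convert! (hρd t ht).div (hrd t ht) this using 1
    rw [hpr t ht]
    field_simp
    simp only [hq]
    ring
  -- the tangential energy decays: `q * r ^ (1 + δ)` is nonincreasing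
  obtain ⟨K, hK0, hK⟩ : ∃ K, 0 ≤ K ∧ ∀ t, T + 1 ≤ t → q t * r t ^ (1 + δ) ≤ K := by
    obtain ⟨K, hK⟩ := exists_le_of_hasDerivAt_nonneg (f := fun t ↦ -(q t * r t ^ (1 + δ))) (T := T)
      (fun t ht ↦ (((hpd t ht).pow 2).const_sub (c ^ 2) |>.mul
        ((hrd t ht).rpow_const (p := 1 + δ) (Or.inl (hr0 t ht).ne'))).neg)
      (fun t ht ↦ by
        have h1 := hδ (x t) (w t)
        rw [hqw t ht] at h1
        have h2 : r t ^ (1 + δ) = r t ^ (1 + δ - 1) * r t := by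
          rw [← Real.rpow_add_one (hr0 t ht).ne']; congr 1; ring
        have h3 : 0 ≤ p t * r t ^ (1 + δ - 1) * (fderiv ℝ g (x t) (x t) (w t) (w t)
            - (δ - 1) * q t) :=
          mul_nonneg (mul_nonneg (hp0 t ht).le (Real.rpow_nonneg (hr0 t ht).le _)) (by linarith)
        refine h3.trans_eq ?_
        have := (hr0 t ht).ne'
        rw [h2]
        simp only [hq, Pi.pow_apply, Nat.cast_ofNat, Nat.add_one_sub_one, pow_one]
        field_simp
        ring)
    refine ⟨-K, ?_, fun t ht ↦ by linarith [hK t ht]⟩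
    have h1 := hq0 (T + 1) (by simp)
    have h2 := Real.rpow_nonneg (hr0 (T + 1) (by simp)).le (1 + δ)
    linarith [hK (T + 1) le_rfl, mul_nonneg h1 h2]
  have hT1 : 0 < T + 1 := by linarith
  have hT' : ∀ t > T + 1, t > T := fun t ht ↦ by linarith
  have hrt : ∀ t > T + 1, r t ^ (-(1 + δ)) ≤ a ^ (-(1 + δ)) * t ^ (-(1 + δ)) := fun t ht ↦ by
    rw [← Real.mul_rpow ha.le (by linarith)]
    exact Real.rpow_le_rpow_of_nonpos (mul_pos ha (by linarith)) (hra t (hT' t ht)) (by linarith)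
  have hqK : ∀ t > T + 1, q t ≤ K * r t ^ (-(1 + δ)) := fun t ht ↦ by
    have := Real.rpow_pos_of_pos (hr0 t (hT' t ht)) (1 + δ)
    rw [Real.rpow_neg (hr0 t (hT' t ht)).le, ← div_eq_mul_inv, le_div_iff₀ this]
    exact hK t (le_of_lt ht)
  -- the direction of `x` converges
  obtain ⟨θ, hθ⟩ : ∃ θ, Tendsto (fun t ↦ (r t)⁻¹ • x t) atTop (𝓝 θ) := by
    obtain ⟨C, hC0, hC⟩ := h.exists_norm_sq_le hδ
    refine exists_tendsto_of_hasDerivAt_norm_le (T := T + 1) (f' := fun t ↦ (r t)⁻¹ • w t)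
      (B := √(C * K) * a ^ (-(1 + δ))) hT1 hδ₀ (fun t ht ↦ ?_) (fun t ht ↦ ?_)
    · have h0 := (hr0 t (hT' t ht)).ne'
      convert! ((hrd t (hT' t ht)).inv h0).smul (hx t (hT' t ht)) using 1
      simp only [hw, smul_sub, smul_smul]
      rw [sub_eq_add_neg, ← neg_smul]
      congr 2
      field_simp
    · rw [mul_assoc]
      refine le_trans ?_ (mul_le_mul_of_nonneg_left (hrt t ht) (Real.sqrt_nonneg _))
      have h0 := hr0 t (hT' t ht)
      have hrp : r t ^ (1 - δ) * r t ^ (-(1 + δ)) = (r t * r t ^ (-(1 + δ))) ^ 2 := by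
        have : r t * r t ^ (-(1 + δ)) = r t ^ (-δ) := by
          nth_rewrite 1 [← Real.rpow_one (r t)]
          rw [← Real.rpow_add h0]; congr 1; ring
        rw [this, ← Real.rpow_add h0, ← Real.rpow_natCast, ← Real.rpow_mul h0.le]
        congr 1; push_cast; ring
      have h1 : ‖w t‖ ^ 2 ≤ (√(C * K) * (r t * r t ^ (-(1 + δ)))) ^ 2 := by
        rw [mul_pow, Real.sq_sqrt (by positivity), ← hrp]
        have h2 := hC (x t) (w t) (hr1 t (hT' t ht))
        rw [hqw t (hT' t ht)] at h2
        refine h2.trans ((mul_le_mul_of_nonneg_left (hqK t ht) (by positivity)).trans_eq ?_)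
        ring
      have h3 := (sq_le_sq₀ (norm_nonneg _) (by positivity)).1 h1
      rw [norm_smul, norm_inv, Real.norm_of_nonneg h0.le, inv_mul_le_iff₀ h0]
      linarith
  -- the radial velocity converges to the speed `c`, and its defect is integrable
  obtain ⟨b, hb⟩ : ∃ b, Tendsto (fun t ↦ r t - c * t) atTop (𝓝 b) := by
    refine exists_tendsto_of_hasDerivAt_norm_le (T := T + 1) (f' := fun t ↦ p t - c * 1)
      (B := c⁻¹ * K * a ^ (-(1 + δ))) hT1 hδ₀
      (fun t ht ↦ (hrd t (hT' t ht)).sub ((hasDerivAt_id t).const_mul c)) (fun t ht ↦ ?_)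
    have h1 := hp0 t (hT' t ht)
    have h2 : p t ≤ c := (sq_le_sq₀ h1.le hc.le).1 (by linarith [hq0 t (hT' t ht)])
    rw [Real.norm_eq_abs, mul_one, abs_sub_comm, abs_of_nonneg (by linarith), mul_assoc, mul_assoc,
      le_inv_mul_iff₀ hc]
    calc c * (c - p t) ≤ q t := by simp only [hq]; nlinarith
      _ ≤ K * r t ^ (-(1 + δ)) := hqK t ht
      _ ≤ _ := by gcongr; exact hrt t ht
  have hrt' : Tendsto (fun t ↦ t⁻¹ * r t) atTop (𝓝 c) := by
    have h1 := (tendsto_inv_atTop_zero.mul hb).add_const c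
    rw [zero_mul, zero_add] at h1
    refine h1.congr' ?_
    filter_upwards [eventually_gt_atTop 0] with t ht
    field_simp
    ring
  refine ⟨c • θ, (hrt'.smul hθ).congr' ?_⟩
  filter_upwards [eventually_gt_atTop T] with t ht
  rw [smul_smul, mul_assoc, mul_inv_cancel₀ (hr0 t ht).ne', mul_one]

/-- In normal coordinates in which `‖y‖²` is `(1 + δ)`-convex for the metric, every geodesic has an
asymptotic velocity. -/
theorem IsNormalMetric.exists_tendsto_geodesic (h : IsNormalMetric g Γ) {δ : ℝ}
    (hδ₀ : 0 < δ) (hδ : ∀ y w, (1 + δ) * g y w w ≤ 2 * ‖w‖ ^ 2 - 2 * inner ℝ y (Γ y w))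
    {x v : ℝ → E} {T : ℝ} (hx : ∀ t > T, HasDerivAt x (v t) t)
    (hv : ∀ t > T, HasDerivAt v (-Γ (x t) (v t)) t) :
    ∃ z, Tendsto (fun t ↦ t⁻¹ • x t) atTop (𝓝 z) := by
  have hspeed := eq_of_hasDerivAt_zero fun t ht ↦ h.hasDerivAt_speed (hx t ht) (hv t ht)
  set k := g (x (T + 1)) (v (T + 1)) (v (T + 1))
  have hk0 : 0 ≤ k := h.nonneg _ _
  rcases hk0.eq_or_lt with hk | hk
  · have hv0 : ∀ t > T, v t = 0 := fun t ht ↦ by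
      by_contra hne
      exact (h.pos (x t) _ hne).ne' ((hspeed t ht).trans hk.symm)
    have hxc := eq_of_hasDerivAt_zero fun t ht ↦ hv0 t ht ▸ hx t ht
    refine ⟨(0 : ℝ) • x (T + 1), (tendsto_inv_atTop_zero.smul_const _).congr' ?_⟩
    filter_upwards [eventually_gt_atTop T] with t ht
    rw [hxc t ht]
  · have hgrow := eventually_quadratic_growth (f := fun t ↦ ‖x t‖ ^ 2)
      (k := k / 2) (half_pos hk) (fun t ht ↦ (hx t ht).norm_sq)
      (fun t ht ↦ ((hx t ht).inner ℝ (hv t ht)).const_mul 2) (fun t ht ↦ by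
        have h1 := hδ (x t) (v t)
        rw [hspeed t ht] at h1
        rw [real_inner_self_eq_norm_sq, inner_neg_right]
        nlinarith)
    obtain ⟨T', hT'⟩ := eventually_atTop.1 hgrow
    set a := √(k / 8)
    have ha : 0 < a := Real.sqrt_pos.2 (by linarith)
    have ha2 : a ^ 2 = k / 8 := Real.sq_sqrt (by linarith)
    set T₁ := max (max T T') (max 1 a⁻¹) with hT₁
    have hTT₁ : T ≤ T₁ := (le_max_left _ _).trans (le_max_left _ _)
    have hT'T₁ : T' ≤ T₁ := (le_max_right _ _).trans (le_max_left _ _)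
    have h1T₁ : 1 ≤ T₁ := (le_max_left _ _).trans (le_max_right _ _)
    have haT₁ : a⁻¹ ≤ T₁ := (le_max_right _ _).trans (le_max_right _ _)
    have hra : ∀ t > T₁, a * t ≤ ‖x t‖ := fun t ht ↦ by
      refine (sq_le_sq₀ (mul_nonneg ha.le (by linarith)) (norm_nonneg _)).1 ?_
      rw [mul_pow, ha2]
      linarith [(hT' t (hT'T₁.trans (le_of_lt ht))).2]
    refine h.exists_tendsto_of_escaping hδ₀ (fun y w ↦ ?_) (T := T₁) (a := a) (c := √k)
      (by linarith) ha (Real.sqrt_pos.2 hk) (fun t ht ↦ hx t (hTT₁.trans_lt ht))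
      (fun t ht ↦ hv t (hTT₁.trans_lt ht))
      (fun t ht ↦ by rw [Real.sq_sqrt hk0]; exact hspeed t (hTT₁.trans_lt ht))
      (fun t ht ↦ by linarith [(hT' t (hT'T₁.trans (le_of_lt ht))).1])
      (fun t ht ↦ ?_) hra
    · have := hδ y w
      rw [h.hessian_norm_sq] at this
      linarith
    · refine le_trans ?_ (hra t ht)
      have : a * a⁻¹ ≤ a * t := by gcongr; exact haT₁.trans (le_of_lt ht)
      rwa [mul_inv_cancel₀ ha.ne'] at this

end Asymptotics

/-! ### The metric and the Christoffel symbols in a global chart -/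

/-- The target is an abstract normed space so that it also applies to spaces of bilinear forms. -/
lemma _root_.ContDiff.smul_vector {E F : Type*} [NormedAddCommGroup E] [NormedSpace ℝ E]
    [NormedAddCommGroup F] [NormedSpace ℝ F] {n : ℕ∞ω} {f : E → ℝ} (hf : ContDiff ℝ n f) (c : F) :
    ContDiff ℝ n fun y ↦ f y • c :=
  hf.smul contDiff_const

section GlobalChart

set_option synthInstance.maxHeartbeats 200000

variable {d : ℕ}

lemma sum_smul_stdVec (u : EuclideanSpace ℝ (Fin d)) : ∑ i, u i • stdVec d i = u := by
  ext k
  simp [stdVec, Finset.sum_apply, Pi.single_apply]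

lemma fderiv_eq_sum_pderiv (F : EuclideanSpace ℝ (Fin d) → ℝ) (y u : EuclideanSpace ℝ (Fin d)) :
    fderiv ℝ F y u = ∑ k, u k * pderiv k F y := by
  conv_lhs => rw [← sum_smul_stdVec u]
  simp [map_sum, pderiv]

variable {M : Type*} [MetricSpace M] [ChartedSpace (EuclideanSpace ℝ (Fin d)) M]
  {e : OpenPartialHomeomorph M (EuclideanSpace ℝ (Fin d))}

lemma contMDiff_symm_of_target_eq_univ (he : e ∈ IsManifold.maximalAtlas (𝓡 d) ∞ M)
    (ht : e.target = univ) : ContMDiff (𝓡 d) (𝓡 d) ∞ e.symm := by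
  rw [← contMDiffOn_univ, ← ht]
  exact contMDiffOn_symm_of_mem_maximalAtlas he

lemma contMDiff_of_source_eq_univ (he : e ∈ IsManifold.maximalAtlas (𝓡 d) ∞ M)
    (hs : e.source = univ) : ContMDiff (𝓡 d) (𝓡 d) ∞ e := by
  rw [← contMDiffOn_univ, ← hs]
  exact contMDiffOn_of_mem_maximalAtlas he

lemma mfderiv_symm_ne_zero (he : e ∈ IsManifold.maximalAtlas (𝓡 d) ∞ M)
    (hs : e.source = univ) (ht : e.target = univ) (y : EuclideanSpace ℝ (Fin d))
    {u : EuclideanSpace ℝ (Fin d)} (hu : u ≠ 0) :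
    (mfderiv (𝓡 d) (𝓡 d) e.symm y u : TangentSpace (𝓡 d) (e.symm y)) ≠ 0 := by
  intro h0
  have h1 : MDifferentiableAt (𝓡 d) (𝓡 d) e.symm y :=
    (contMDiff_symm_of_target_eq_univ he ht).mdifferentiable (by simp) y
  have h2 : MDifferentiableAt (𝓡 d) (𝓡 d) e (e.symm y) :=
    (contMDiff_of_source_eq_univ he hs).mdifferentiable (by simp) _
  have h3 := mfderiv_comp y h2 h1
  have h4 : (e ∘ e.symm) = id := by
    ext1 z
    exact e.right_inv (by simp [ht])
  rw [h4, mfderiv_id] at h3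
  have h5 := DFunLike.congr_fun h3 u
  apply hu
  refine h5.trans ?_
  exact (congrArg (mfderiv (𝓡 d) (𝓡 d) e (e.symm y)) h0).trans (map_zero _)

variable [RiemannianBundle (fun x : M ↦ TangentSpace (𝓡 d) x)]

/-- The metric `g` read in the coordinates `e`, as a field of bilinear forms. -/
noncomputable def metricForm (e : OpenPartialHomeomorph M (EuclideanSpace ℝ (Fin d)))
    (y : EuclideanSpace ℝ (Fin d)) :
    EuclideanSpace ℝ (Fin d) →L[ℝ] EuclideanSpace ℝ (Fin d) →L[ℝ] ℝ :=
  ∑ i, ∑ j, metricMatrix e y i j •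
    (EuclideanSpace.proj i : EuclideanSpace ℝ (Fin d) →L[ℝ] ℝ).smulRight
      (EuclideanSpace.proj j : EuclideanSpace ℝ (Fin d) →L[ℝ] ℝ)

/-- The quadratic map `v ↦ Γ_y(v, v)` in the coordinates `e`. -/
noncomputable def christoffelMap (e : OpenPartialHomeomorph M (EuclideanSpace ℝ (Fin d)))
    (y v : EuclideanSpace ℝ (Fin d)) : EuclideanSpace ℝ (Fin d) :=
  WithLp.toLp 2 fun k ↦ ∑ i, ∑ j, christoffel e k i j y * v i * v j

lemma metricForm_apply (y u w : EuclideanSpace ℝ (Fin d)) :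
    metricForm e y u w = ∑ i, ∑ j, metricMatrix e y i j * u i * w j := by
  simp [metricForm, sum_apply, mul_assoc]

lemma metricForm_eq_inner (y u w : EuclideanSpace ℝ (Fin d)) :
    metricForm e y u w
      = inner ℝ (mfderiv (𝓡 d) (𝓡 d) e.symm y u : TangentSpace (𝓡 d) (e.symm y))
          (mfderiv (𝓡 d) (𝓡 d) e.symm y w : TangentSpace (𝓡 d) (e.symm y)) := by
  have key : ∀ u : EuclideanSpace ℝ (Fin d),
      (mfderiv (𝓡 d) (𝓡 d) e.symm y u : TangentSpace (𝓡 d) (e.symm y))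
        = ∑ i, u i • coordVec e i y := fun u ↦ by
    conv_lhs => rw [← sum_smul_stdVec u]
    exact (map_sum (mfderiv (𝓡 d) (𝓡 d) e.symm y) _ _).trans
      (Finset.sum_congr rfl fun i _ ↦ map_smul (mfderiv (𝓡 d) (𝓡 d) e.symm y) _ _)
  rw [key u, key w, metricForm_apply, sum_inner]
  refine Finset.sum_congr rfl fun i _ ↦ ?_
  rw [inner_sum]
  refine Finset.sum_congr rfl fun j _ ↦ ?_
  rw [inner_smul_left, inner_smul_right, conj_trivial, metricMatrix, Matrix.of_apply]
  ring

lemma metricMatrix_symm (y : EuclideanSpace ℝ (Fin d)) (i j : Fin d) :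
    metricMatrix e y i j = metricMatrix e y j i := by
  simp [metricMatrix, real_inner_comm]

lemma metricForm_symm (y u w : EuclideanSpace ℝ (Fin d)) :
    metricForm e y u w = metricForm e y w u := by
  rw [metricForm_eq_inner, metricForm_eq_inner, real_inner_comm]

lemma metricForm_sq_le (y u w : EuclideanSpace ℝ (Fin d)) :
    metricForm e y u w ^ 2 ≤ metricForm e y u u * metricForm e y w w := by
  rw [metricForm_eq_inner, metricForm_eq_inner, metricForm_eq_inner, sq]
  exact real_inner_mul_inner_self_le _ _

lemma metricForm_pos (he : e ∈ IsManifold.maximalAtlas (𝓡 d) ∞ M)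
    (hs : e.source = univ) (ht : e.target = univ) (y : EuclideanSpace ℝ (Fin d))
    {u : EuclideanSpace ℝ (Fin d)} (hu : u ≠ 0) : 0 < metricForm e y u u := by
  rw [metricForm_eq_inner]
  exact real_inner_self_pos.2 (mfderiv_symm_ne_zero he hs ht y hu)

lemma isUnit_det_metricMatrix (he : e ∈ IsManifold.maximalAtlas (𝓡 d) ∞ M)
    (hs : e.source = univ) (ht : e.target = univ) (y : EuclideanSpace ℝ (Fin d)) :
    IsUnit (metricMatrix e y).det := by
  rw [isUnit_iff_ne_zero]
  intro h0
  obtain ⟨u, hu, hGu⟩ := Matrix.exists_mulVec_eq_zero_iff.2 h0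
  have h1 := metricForm_pos he hs ht y (u := WithLp.toLp 2 u) (by simpa using hu)
  rw [metricForm_apply] at h1
  refine h1.ne' ?_
  have h2 : ∀ i, ∑ j, metricMatrix e y i j * u j = 0 := fun i ↦ congrFun hGu i
  calc _ = ∑ i, u i * ∑ j, metricMatrix e y i j * u j := by
        refine Finset.sum_congr rfl fun i _ ↦ ?_
        rw [Finset.mul_sum]
        exact Finset.sum_congr rfl fun j _ ↦ by simp only; ring
    _ = 0 := by simp [h2]

/-- Lowering the index of the Christoffel symbols. -/
lemma sum_metricMatrix_mul_christoffel (he : e ∈ IsManifold.maximalAtlas (𝓡 d) ∞ M)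
    (hs : e.source = univ) (ht : e.target = univ) (y : EuclideanSpace ℝ (Fin d)) (b i j : Fin d) :
    ∑ a, metricMatrix e y b a * christoffel e a i j y
      = 2⁻¹ * (pderiv i (fun z ↦ metricMatrix e z b j) y
          + pderiv j (fun z ↦ metricMatrix e z b i) y
          - pderiv b (fun z ↦ metricMatrix e z i j) y) := by
  have h1 := Matrix.mul_nonsing_inv _ (isUnit_det_metricMatrix he hs ht y)
  set S : Fin d → ℝ := fun l ↦ pderiv i (fun z ↦ metricMatrix e z l j) y
          + pderiv j (fun z ↦ metricMatrix e z l i) y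
          - pderiv l (fun z ↦ metricMatrix e z i j) y
  have h2 : (metricMatrix e y).mulVec ((metricMatrix e y)⁻¹.mulVec S) b = S b := by
    rw [Matrix.mulVec_mulVec, h1, Matrix.one_mulVec]
  change _ = 2⁻¹ * S b
  rw [← h2]
  simp only [Matrix.mulVec, dotProduct, christoffel, Finset.mul_sum, S]
  exact Finset.sum_congr rfl fun a _ ↦ Finset.sum_congr rfl fun l _ ↦ by ring

variable [IsManifold (𝓡 d) ∞ M]
  [IsContMDiffRiemannianBundle (𝓡 d) ∞ (EuclideanSpace ℝ (Fin d))
      (fun x : M ↦ TangentSpace (𝓡 d) x)]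

lemma contDiff_metricMatrix (he : e ∈ IsManifold.maximalAtlas (𝓡 d) ∞ M)
    (ht : e.target = univ) (i j : Fin d) : ContDiff ℝ ∞ fun y ↦ metricMatrix e y i j := by
  have hT : ContMDiff (𝓡 d).tangent (𝓡 d).tangent ∞ (tangentMap (𝓡 d) (𝓡 d) e.symm) :=
    (contMDiff_symm_of_target_eq_univ he ht).contMDiff_tangentMap le_rfl
  have hsec : ∀ i, ContMDiff (𝓡 d) (𝓡 d).tangent ∞ (fun y : EuclideanSpace ℝ (Fin d) ↦
      (⟨e.symm y, coordVec e i y⟩ : TangentBundle (𝓡 d) M)) := fun i ↦ by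
    have hV : ContMDiff (𝓡 d) (𝓡 d).tangent ∞ (fun y ↦
        (⟨y, stdVec d i⟩ : TangentBundle (𝓡 d) (EuclideanSpace ℝ (Fin d)))) :=
      contMDiff_vectorSpace_iff_contDiff.2 contDiff_const
    exact hT.comp hV
  exact contMDiff_iff_contDiff.1 ((hsec i).inner_bundle (hsec j))

lemma contDiff_metricForm (he : e ∈ IsManifold.maximalAtlas (𝓡 d) ∞ M)
    (ht : e.target = univ) : ContDiff ℝ 1 (metricForm e) := by
  unfold metricForm
  refine ContDiff.sum fun i _ ↦ ContDiff.sum fun j _ ↦ ?_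
  exact ((contDiff_metricMatrix he ht i j).of_le (by simp)).smul_vector _

lemma fderiv_metricForm (he : e ∈ IsManifold.maximalAtlas (𝓡 d) ∞ M)
    (ht : e.target = univ) (y h u w : EuclideanSpace ℝ (Fin d)) :
    fderiv ℝ (metricForm e) y h u w
      = ∑ k, ∑ i, ∑ j, h k * pderiv k (fun z ↦ metricMatrix e z i j) y * u i * w j := by
  have hline : HasDerivAt (fun s : ℝ ↦ y + s • h) h 0 := by
    simpa using ((hasDerivAt_id (0 : ℝ)).smul_const h).const_add y
  have hG : ∀ i j, ContDiff ℝ 1 fun y ↦ metricMatrix e y i j := fun i j ↦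
    (contDiff_metricMatrix he ht i j).of_le (by simp)
  have h1 := (((contDiff_metricForm he ht).hasDerivAt_comp hline).clm_apply
    (hasDerivAt_const 0 u)).clm_apply (hasDerivAt_const 0 w)
  have h2 : HasDerivAt (fun s : ℝ ↦ metricForm e (y + s • h) u w)
      (∑ i, ∑ j, fderiv ℝ (fun z ↦ metricMatrix e z i j) y h * u i * w j) 0 := by
    simp only [metricForm_apply]
    refine HasDerivAt.fun_sum fun i _ ↦ HasDerivAt.fun_sum fun j _ ↦ ?_
    have := (hG i j).hasDerivAt_comp hline
    simp only [zero_smul, add_zero] at this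
    exact (this.mul_const _).mul_const _
  have h3 := h1.unique h2
  simp only [zero_smul, add_zero, map_zero] at h3
  rw [h3]
  simp only [fderiv_eq_sum_pderiv, Finset.sum_mul]
  rw [Finset.sum_comm_cycle]

lemma contDiff_inv_metricMatrix (he : e ∈ IsManifold.maximalAtlas (𝓡 d) ∞ M)
    (hs : e.source = univ) (ht : e.target = univ) (i j : Fin d) :
    ContDiff ℝ ∞ fun y ↦ (metricMatrix e y)⁻¹ i j := by
  have hdet : ∀ A : EuclideanSpace ℝ (Fin d) → Matrix (Fin d) (Fin d) ℝ,
      (∀ k l, ContDiff ℝ ∞ fun y ↦ A y k l) → ContDiff ℝ ∞ fun y ↦ (A y).det := fun A hA ↦ by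
    simp only [Matrix.det_apply']
    exact ContDiff.sum fun σ _ ↦ contDiff_const.mul (contDiff_prod fun k _ ↦ hA _ _)
  have hG := contDiff_metricMatrix he ht
  simp only [Matrix.inv_def, Matrix.smul_apply, smul_eq_mul, Ring.inverse_eq_inv',
    Matrix.adjugate_apply]
  refine ((hdet _ hG).inv fun y ↦ (isUnit_det_metricMatrix he hs ht y).ne_zero).mul
    (hdet _ fun k l ↦ ?_)
  by_cases hk : k = j
  · subst hk
    simpa using contDiff_const
  · simpa [Matrix.updateRow_ne hk] using hG k l

lemma contDiff_christoffel (he : e ∈ IsManifold.maximalAtlas (𝓡 d) ∞ M)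
    (hs : e.source = univ) (ht : e.target = univ) (k i j : Fin d) :
    ContDiff ℝ 1 (christoffel e k i j) := by
  have hp : ∀ k i j, ContDiff ℝ 1 (pderiv k fun z ↦ metricMatrix e z i j) := fun k i j ↦
    ((contDiff_metricMatrix he ht i j).fderiv_right (m := 1) (by norm_cast)).clm_apply
      contDiff_const
  unfold christoffel
  exact contDiff_const.mul (ContDiff.sum fun l _ ↦
    ((contDiff_inv_metricMatrix he hs ht k l).of_le (by simp)).mul
      (((hp _ _ _).add (hp _ _ _)).sub (hp _ _ _)))

lemma contDiff_christoffelMap (he : e ∈ IsManifold.maximalAtlas (𝓡 d) ∞ M)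
    (hs : e.source = univ) (ht : e.target = univ) :
    ContDiff ℝ 1 fun p : EuclideanSpace ℝ (Fin d) × EuclideanSpace ℝ (Fin d) ↦
      christoffelMap e p.1 p.2 := by
  rw [contDiff_euclidean]
  intro k
  have hproj : ∀ i, ContDiff ℝ 1 fun p : EuclideanSpace ℝ (Fin d) × EuclideanSpace ℝ (Fin d) ↦
      p.2 i := fun i ↦ contDiff_euclidean.1 contDiff_snd i
  simp only [christoffelMap]
  exact ContDiff.sum fun i _ ↦ ContDiff.sum fun j _ ↦
    (((contDiff_christoffel he hs ht k i j).comp contDiff_fst).mul (hproj i)).mul (hproj j)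

lemma isMetricWithChristoffel_of_chart (he : e ∈ IsManifold.maximalAtlas (𝓡 d) ∞ M)
    (hs : e.source = univ) (ht : e.target = univ) :
    IsMetricWithChristoffel (metricForm e) (christoffelMap e) where
  contDiff := contDiff_metricForm he ht
  symm := metricForm_symm
  pos y u hu := metricForm_pos he hs ht y hu
  koszul y v u := by
    have hL : metricForm e y (christoffelMap e y v) u
        = ∑ b, ∑ i, ∑ j, (∑ a, metricMatrix e y b a * christoffel e a i j y) * v i * v j * u b := by
      rw [metricForm_symm, metricForm_apply]
      refine Finset.sum_congr rfl fun b _ ↦ ?_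
      simp only [christoffelMap, Finset.mul_sum, Finset.sum_mul]
      rw [Finset.sum_comm]
      refine Finset.sum_congr rfl fun i _ ↦ ?_
      rw [Finset.sum_comm]
      exact Finset.sum_congr rfl fun j _ ↦ Finset.sum_congr rfl fun a _ ↦ by ring
    set A := ∑ b, ∑ i, ∑ j, pderiv i (fun z ↦ metricMatrix e z b j) y * v i * v j * u b with hA
    set B := ∑ b, ∑ i, ∑ j, pderiv b (fun z ↦ metricMatrix e z i j) y * v i * v j * u b with hB
    have hA' : ∑ b, ∑ i, ∑ j, pderiv j (fun z ↦ metricMatrix e z b i) y * v i * v j * u b = A := by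
      refine Finset.sum_congr rfl fun b _ ↦ ?_
      rw [Finset.sum_comm]
      exact Finset.sum_congr rfl fun j _ ↦ Finset.sum_congr rfl fun a _ ↦ by ring
    have h1 : fderiv ℝ (metricForm e) y v v u = A := by
      rw [fderiv_metricForm he ht, hA, Finset.sum_comm_cycle]
      refine Finset.sum_congr rfl fun b _ ↦ Finset.sum_congr rfl fun i _ ↦
        Finset.sum_congr rfl fun j _ ↦ ?_
      simp only [metricMatrix_symm _ j b]
      ring
    have h2 : fderiv ℝ (metricForm e) y u v v = B := by
      rw [fderiv_metricForm he ht, hB]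
      exact Finset.sum_congr rfl fun b _ ↦ Finset.sum_congr rfl fun i _ ↦
        Finset.sum_congr rfl fun j _ ↦ by ring
    rw [hL, h1, h2]
    simp only [sum_metricMatrix_mul_christoffel he hs ht]
    trans 2⁻¹ * (A + A - B)
    · nth_rewrite 2 [← hA']
      simp only [hA, hB, ← Finset.sum_add_distrib, ← Finset.sum_sub_distrib, Finset.mul_sum]
      exact Finset.sum_congr rfl fun b _ ↦ Finset.sum_congr rfl fun i _ ↦
        Finset.sum_congr rfl fun j _ ↦ by ring
    · ring

end GlobalChart

/-! ### Geodesics in a global chart -/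

section Geodesics

set_option synthInstance.maxHeartbeats 200000

variable {d : ℕ} {M : Type*} [MetricSpace M] [ChartedSpace (EuclideanSpace ℝ (Fin d)) M]
  [RiemannianBundle (fun x : M ↦ TangentSpace (𝓡 d) x)]
  {e : OpenPartialHomeomorph M (EuclideanSpace ℝ (Fin d))}

/-- The coordinate expression of a geodesic in a global chart solves the first-order system
`x' = v`, `v' = -Γ_x(v, v)`. -/
lemma IsGeodesicOn.hasDerivAt_chart (he : e ∈ IsManifold.maximalAtlas (𝓡 d) ∞ M)
    (hs : e.source = univ) {γ : ℝ → M} {s : Set ℝ} (hγ : IsGeodesicOn (d := d) γ s)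
    (hso : IsOpen s) {t : ℝ} (ht : t ∈ s) :
    HasDerivAt (fun τ ↦ e (γ τ)) (deriv (fun τ ↦ e (γ τ)) t) t ∧
      HasDerivAt (deriv fun τ ↦ e (γ τ))
        (-christoffelMap e (e (γ t)) (deriv (fun τ ↦ e (γ τ)) t)) t := by
  set x : ℝ → EuclideanSpace ℝ (Fin d) := fun τ ↦ e (γ τ) with hx
  have hC : ContDiffOn ℝ 2 x s := contMDiffOn_iff_contDiffOn.1
    (((contMDiff_of_source_eq_univ he hs).of_le (by norm_cast)).comp_contMDiffOn
      hγ.contMDiffOn)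
  have hd : ∀ τ ∈ s, HasDerivAt x (deriv x τ) τ := fun τ hτ ↦
    ((hC.contDiffAt (hso.mem_nhds hτ)).differentiableAt two_ne_zero).hasDerivAt
  have hd2 : HasDerivAt (deriv x) (deriv (deriv x) t) t :=
    ((((contDiffOn_succ_iff_deriv_of_isOpen (n := 1) hso).1
      (by rwa [one_add_one_eq_two])).2.2.contDiffAt (hso.mem_nhds ht)).differentiableAt
        one_ne_zero).hasDerivAt
  refine ⟨hd t ht, ?_⟩
  have hcoord : ∀ k, ∀ {y : ℝ → EuclideanSpace ℝ (Fin d)} {y' : EuclideanSpace ℝ (Fin d)} {τ : ℝ},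
      HasDerivAt y y' τ → HasDerivAt (fun τ ↦ y τ k) (y' k) τ := fun k _ _ _ h ↦
    (EuclideanSpace.proj (𝕜 := ℝ) k).hasFDerivAt.comp_hasDerivAt _ h
  convert! hd2 using 1
  ext k
  have h1 := hγ.equation e he t ht (by simp [hs]) k
  have h2 : (deriv fun τ ↦ e (γ τ) k) =ᶠ[𝓝 t] fun τ ↦ deriv x τ k := by
    filter_upwards [hso.mem_nhds ht] with τ hτ
    exact (hcoord k (hd τ hτ)).deriv
  have h3 : ∀ i, deriv (fun τ ↦ e (γ τ) i) t = deriv x t i := fun i ↦ (hcoord i (hd t ht)).deriv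
  rw [h2.deriv_eq, (hcoord k hd2).deriv] at h1
  simp only [h3] at h1
  simp only [christoffelMap, PiLp.neg_apply]
  linarith

lemma IsGeodesicFrom.apply_zero {o : M} {v : TangentSpace (𝓡 d) o} {γ : ℝ → M}
    (hγ : IsGeodesicFrom (d := d) o v γ) : γ 0 = o :=
  congrArg TotalSpace.proj hγ.2

/-- A global chart is an isometry onto `ℝ^d` with the metric `metricForm e`. -/
lemma metricForm_mfderiv (he : e ∈ IsManifold.maximalAtlas (𝓡 d) ∞ M)
    (hs : e.source = univ) (ht : e.target = univ) (p : M) (w : TangentSpace (𝓡 d) p) :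
    metricForm e (e p) (mfderiv (𝓡 d) (𝓡 d) e p w) (mfderiv (𝓡 d) (𝓡 d) e p w) = ‖w‖ ^ 2 := by
  have h1 : tangentMap (𝓡 d) (𝓡 d) e.symm (tangentMap (𝓡 d) (𝓡 d) e ⟨p, w⟩)
      = (⟨p, w⟩ : TangentBundle (𝓡 d) M) := by
    have h4 : (e.symm ∘ e) = id := by
      ext1 z
      exact e.left_inv (by simp [hs])
    have := tangentMap_comp (I := 𝓡 d) (I' := 𝓡 d) (I'' := 𝓡 d)
      ((contMDiff_symm_of_target_eq_univ he ht).mdifferentiable (by simp))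
      ((contMDiff_of_source_eq_univ he hs).mdifferentiable (by simp))
    rw [h4, tangentMap_id] at this
    exact (congrFun this ⟨p, w⟩).symm
  refine ((metricForm_eq_inner _ _ _).trans (real_inner_self_eq_norm_sq _)).trans ?_
  exact congrArg (fun q : TangentBundle (𝓡 d) M ↦ ‖q.2‖ ^ 2) h1

lemma IsGeodesicFrom.deriv_chart (he : e ∈ IsManifold.maximalAtlas (𝓡 d) ∞ M)
    (hs : e.source = univ) {o : M} {v : TangentSpace (𝓡 d) o} {γ : ℝ → M}
    (hγ : IsGeodesicFrom (d := d) o v γ) :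
    deriv (fun τ ↦ e (γ τ)) 0 = mfderiv (𝓡 d) (𝓡 d) e o v := by
  have h0 := hγ.apply_zero
  subst h0
  have h1 : mfderiv 𝓘(ℝ, ℝ) (𝓡 d) γ 0 (1 : ℝ) = v :=
    eq_of_heq (TotalSpace.mk.inj hγ.2).2
  have h2 : MDifferentiableAt 𝓘(ℝ, ℝ) (𝓡 d) γ 0 :=
    (hγ.1.contMDiffOn.contMDiffAt univ_mem).mdifferentiableAt two_ne_zero
  have h3 := mfderiv_comp (0 : ℝ)
    ((contMDiff_of_source_eq_univ he hs).mdifferentiable (by simp) (γ 0)) h2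
  rw [← h1]
  refine Eq.trans ?_ (DFunLike.congr_fun h3 (1 : ℝ))
  rw [mfderiv_eq_fderiv]
  exact (fderiv_apply_one_eq_deriv).symm

end Geodesics

/-! ### Normal coordinates at a pole -/

section NormalChart

set_option synthInstance.maxHeartbeats 200000

variable {d : ℕ} {M : Type*} [MetricSpace M] [ChartedSpace (EuclideanSpace ℝ (Fin d)) M]
  [RiemannianBundle (fun x : M ↦ TangentSpace (𝓡 d) x)]
  {o : M} {L : TangentSpace (𝓡 d) o ≃ₗᵢ[ℝ] EuclideanSpace ℝ (Fin d)}
  {e : OpenPartialHomeomorph M (EuclideanSpace ℝ (Fin d))}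

/-- `e` is the global chart of normal coordinates centred at the pole `o`, with respect to the
identification `L` of `T_oM` with `ℝ^d`. -/
structure IsNormalChart (o : M) (L : TangentSpace (𝓡 d) o ≃ₗᵢ[ℝ] EuclideanSpace ℝ (Fin d))
    (e : OpenPartialHomeomorph M (EuclideanSpace ℝ (Fin d))) : Prop where
  mem_maximalAtlas : e ∈ IsManifold.maximalAtlas (𝓡 d) ∞ M
  source_eq : e.source = univ
  target_eq : e.target = univ
  apply_expMap : ∀ v, e (expMap (d := d) o v) = L v

lemma IsPole.exists_isNormalChart [IsManifold (𝓡 d) ∞ M] (ho : IsPole (d := d) o) :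
    ∃ (L : TangentSpace (𝓡 d) o ≃ₗᵢ[ℝ] EuclideanSpace ℝ (Fin d))
      (e : OpenPartialHomeomorph M (EuclideanSpace ℝ (Fin d))), IsNormalChart o L e := by
  obtain ⟨Φ, hΦ⟩ := ho
  have hfd : FiniteDimensional ℝ (TangentSpace (𝓡 d) o) :=
    inferInstanceAs (FiniteDimensional ℝ (EuclideanSpace ℝ (Fin d)))
  -- the vector space underlying `T_oM` is `ℝ^d`, but its scalar product is the one of the metric
  have hrank : Module.finrank ℝ (TangentSpace (𝓡 d) o) = d :=
    (finrank_euclideanSpace_fin (𝕜 := ℝ) (n := d))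
  let L : TangentSpace (𝓡 d) o ≃ₗᵢ[ℝ] EuclideanSpace ℝ (Fin d) :=
    ((stdOrthonormalBasis ℝ (TangentSpace (𝓡 d) o)).reindex (finCongr hrank)).repr
  let Ψ := Φ.symm.trans L.toContinuousLinearEquiv.toDiffeomorph
  refine ⟨L, Ψ.toHomeomorph.toOpenPartialHomeomorph, ?_, rfl, rfl, fun v ↦ ?_⟩
  · exact OpenPartialHomeomorph.mem_maximalAtlas_of_contMDiffOn _ Ψ.contMDiff.contMDiffOn
      Ψ.symm.contMDiff.contMDiffOn
  · rw [← hΦ]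
    change L (Φ.symm (Φ v)) = L v
    rw [Φ.symm_apply_apply]

namespace IsNormalChart

lemma injective (h : IsNormalChart o L e) : Function.Injective e := fun p q hpq ↦
  e.injOn (by simp [h.source_eq]) (by simp [h.source_eq]) hpq

lemma expMap_eq (h : IsNormalChart o L e) (v : TangentSpace (𝓡 d) o) :
    expMap (d := d) o v = e.symm (L v) := by
  rw [← h.apply_expMap, e.left_inv (by simp [h.source_eq])]

lemma expMap_symm_apply (h : IsNormalChart o L e) (p : M) :
    expMap (d := d) o (L.symm (e p)) = p :=
  h.injective (by rw [h.apply_expMap, L.apply_symm_apply])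

lemma invFun_expMap (h : IsNormalChart o L e) (p : M) :
    Function.invFun (expMap (d := d) o) p = L.symm (e p) := by
  have hinj : Function.Injective (expMap (d := d) o) := fun v w hvw ↦
    L.injective (by rw [← h.apply_expMap, hvw, h.apply_expMap])
  conv_lhs => rw [← h.expMap_symm_apply p]
  exact Function.leftInverse_invFun hinj _

/-- In normal coordinates the geodesic dilation is the multiplication by `t⁻¹`. -/
lemma dilation_eq (h : IsNormalChart o L e) (t : ℝ) (p : M) :
    dilation d o t p = e.symm (t⁻¹ • e p) := by
  rw [dilation, h.invFun_expMap, h.expMap_eq, map_smul, L.apply_symm_apply]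

variable [IsManifold (𝓡 d) ∞ M]
  [IsContMDiffRiemannianBundle (𝓡 d) ∞ (EuclideanSpace ℝ (Fin d))
      (fun x : M ↦ TangentSpace (𝓡 d) x)]

/-- A geodesic starting at `o` with velocity `s • v` is a reparametrisation of the one with
velocity `v`. -/
lemma geodesic_smul (h : IsNormalChart o L e) {v : TangentSpace (𝓡 d) o} {s : ℝ} {γ η : ℝ → M}
    (hγ : IsGeodesicFrom (d := d) o v γ) (hη : IsGeodesicFrom (d := d) o (s • v) η) :
    η 1 = γ s := by
  have he := h.mem_maximalAtlas
  have hs := h.source_eq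
  have h1 : ∀ t, _ := fun t ↦ hγ.1.hasDerivAt_chart he hs isOpen_univ (mem_univ t)
  have h2 : ∀ t, _ := fun t ↦ hη.1.hasDerivAt_chart he hs isOpen_univ (mem_univ t)
  have hmul : ∀ t : ℝ, HasDerivAt (fun t ↦ s * t) s t := fun t ↦ by
    simpa using (hasDerivAt_id t).const_mul s
  have hsmul : ∀ (y v : EuclideanSpace ℝ (Fin d)),
      christoffelMap e y (s • v) = (s * s) • christoffelMap e y v := fun y v ↦ by
    ext k
    simp only [christoffelMap, PiLp.smul_apply, smul_eq_mul, Finset.mul_sum]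
    exact Finset.sum_congr rfl fun i _ ↦ Finset.sum_congr rfl fun j _ ↦ by ring
  have key := geodesic_unique (contDiff_christoffelMap he hs h.target_eq)
    (fun t ↦ (h2 t).1) (fun t ↦ (h2 t).2) (y := fun t ↦ e (γ (s * t)))
    (w := fun t ↦ s • deriv (fun τ ↦ e (γ τ)) (s * t))
    (fun t ↦ (h1 (s * t)).1.scomp t (hmul t))
    (fun t ↦ by
      convert! ((h1 (s * t)).2.scomp t (hmul t)).const_smul s using 1
      rw [hsmul, smul_neg, smul_neg, smul_smul])
    (by simp only [mul_zero, hγ.apply_zero, hη.apply_zero])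
    (by
      simp only [mul_zero]
      rw [hη.deriv_chart he hs, hγ.deriv_chart he hs]
      exact map_smul (mfderiv (𝓡 d) (𝓡 d) e o) s v)
  apply h.injective
  simpa using congrFun key 1

/-- This holds whether or not `expMap o 0` takes its default value, since that value is `o` as
well. -/
lemma expMap_zero (h : IsNormalChart o L e) : expMap (d := d) o 0 = o := by
  unfold expMap
  split_ifs with hex
  · have := h.geodesic_smul (s := 0) hex.choose_spec (by rw [zero_smul]; exact hex.choose_spec)
    exact this.trans hex.choose_spec.apply_zero
  · rfl

lemma apply_pole (h : IsNormalChart o L e) : e o = 0 := by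
  have := h.apply_expMap 0
  rwa [h.expMap_zero, map_zero] at this

/-- Through the pole there is a geodesic with any given velocity, and in normal coordinates it is a
straight line. -/
lemma exists_geodesic (h : IsNormalChart o L e) {v : TangentSpace (𝓡 d) o} (hv : v ≠ 0) :
    ∃ γ : ℝ → M, IsGeodesicFrom (d := d) o v γ ∧ ∀ s, e (γ s) = s • L v := by
  have hex : ∀ v : TangentSpace (𝓡 d) o, v ≠ 0 → ∃ γ : ℝ → M, IsGeodesicFrom (d := d) o v γ := by
    intro v hv
    -- otherwise `expMap o v` has the default value `o = expMap o 0`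
    by_contra hne
    have h1 : expMap (d := d) o v = o := dif_neg hne
    have h2 := h.apply_expMap v
    rw [h1, h.apply_pole] at h2
    exact hv (L.injective (by rw [← h2, map_zero]))
  obtain ⟨γ, hγ⟩ := hex v hv
  refine ⟨γ, hγ, fun s ↦ ?_⟩
  rcases eq_or_ne s 0 with rfl | hs
  · rw [hγ.apply_zero, h.apply_pole, zero_smul]
  · have hsv := hex (s • v) (smul_ne_zero hs hv)
    have h1 : expMap (d := d) o (s • v) = hsv.choose 1 := dif_pos hsv
    rw [← h.geodesic_smul hγ hsv.choose_spec, ← h1, h.apply_expMap, map_smul]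

/-- The metric at the pole and the vanishing of the Christoffel symbols along lines are read off the
straight geodesics through the pole. -/
lemma isNormalMetric (h : IsNormalChart o L e) :
    IsNormalMetric (metricForm e) (christoffelMap e) where
  toIsMetricWithChristoffel :=
    isMetricWithChristoffel_of_chart h.mem_maximalAtlas h.source_eq h.target_eq
  apply_zero u := by
    rcases eq_or_ne u 0 with rfl | hu
    · rw [map_zero, norm_zero, zero_pow two_ne_zero]
    · obtain ⟨γ, hγ, hline⟩ := h.exists_geodesic (v := L.symm u) (by simpa using hu)
      have h1 := hγ.deriv_chart h.mem_maximalAtlas h.source_eq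
      simp only [hline, L.apply_symm_apply] at h1
      have h2 : deriv (fun τ : ℝ ↦ τ • u) 0 = u := by
        simpa using ((hasDerivAt_id (0 : ℝ)).smul_const u).deriv
      have h3 := metricForm_mfderiv h.mem_maximalAtlas h.source_eq h.target_eq o (L.symm u)
      rw [h2] at h1
      rw [L.symm.norm_map, h.apply_pole] at h3
      refine Eq.trans ?_ h3
      exact congrArg (fun w : EuclideanSpace ℝ (Fin d) ↦ metricForm e 0 w w) h1
  christoffel_line s u := by
    rcases eq_or_ne u 0 with rfl | hu
    · ext k
      simp [christoffelMap]
    · obtain ⟨γ, hγ, hline⟩ := h.exists_geodesic (v := L.symm u) (by simpa using hu)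
      have h1 := (hγ.1.hasDerivAt_chart h.mem_maximalAtlas h.source_eq isOpen_univ
        (mem_univ s)).2
      simp only [hline, L.apply_symm_apply] at h1
      have h2 : deriv (fun τ : ℝ ↦ τ • u) = fun _ ↦ u := by
        ext1 τ
        simpa using ((hasDerivAt_id τ).smul_const u).deriv
      rw [h2] at h1
      simpa using (h1.unique (hasDerivAt_const s u))

end IsNormalChart

end NormalChart

/-! ### The distance to the pole -/

section Distance

open MeasureTheory

set_option synthInstance.maxHeartbeats 200000

variable {d : ℕ} {M : Type*} [MetricSpace M] [ChartedSpace (EuclideanSpace ℝ (Fin d)) M]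
  [RiemannianBundle (fun x : M ↦ TangentSpace (𝓡 d) x)]
  {o : M} {L : TangentSpace (𝓡 d) o ≃ₗᵢ[ℝ] EuclideanSpace ℝ (Fin d)}
  {e : OpenPartialHomeomorph M (EuclideanSpace ℝ (Fin d))}

namespace IsNormalChart

variable [IsManifold (𝓡 d) ∞ M]
  [IsContMDiffRiemannianBundle (𝓡 d) ∞ (EuclideanSpace ℝ (Fin d))
      (fun x : M ↦ TangentSpace (𝓡 d) x)]

/-- By the Gauss lemma the metric dominates the square of the radial velocity. -/
lemma abs_inner_le (h : IsNormalChart o L e) (p : M) (w : TangentSpace (𝓡 d) p) :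
    |(inner ℝ (e p) (mfderiv (𝓡 d) (𝓡 d) e p w : EuclideanSpace ℝ (Fin d)) : ℝ)|
      ≤ ‖e p‖ * ‖w‖ := by
  have h1 := metricForm_mfderiv h.mem_maximalAtlas h.source_eq h.target_eq p w
  set u : EuclideanSpace ℝ (Fin d) := mfderiv (𝓡 d) (𝓡 d) e p w
  rw [← h.isNormalMetric.gauss]
  refine abs_le_of_sq_le_sq ?_ (by positivity)
  have h2 := h.isNormalMetric.apply_self_self (e p)
  rw [mul_pow, ← h1, ← h2]
  exact metricForm_sq_le _ _ _

variable [IsRiemannianManifold (𝓡 d) M]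

lemma dist_le_norm (h : IsNormalChart o L e) (p : M) : dist p o ≤ ‖e p‖ := by
  have hsmooth := contMDiff_symm_of_target_eq_univ h.mem_maximalAtlas h.target_eq
  set η : ℝ → M := fun s ↦ e.symm (s • e p) with hη
  have hline : ∀ s : ℝ, HasDerivAt (fun s : ℝ ↦ s • e p) (e p) s := fun s ↦ by
    simpa using (hasDerivAt_id s).smul_const (e p)
  have hη1 : ContMDiff 𝓘(ℝ, ℝ) (𝓡 d) 1 η :=
    (hsmooth.of_le (by norm_cast)).comp
      (contMDiff_iff_contDiff.2 (contDiff_id.smul contDiff_const))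
  have h1 := riemannianEDist_le_pathELength (I := 𝓡 d) (a := 0) (b := 1) hη1.contMDiffOn
    (x := o) (y := p)
    (by simp only [hη, zero_smul]; rw [← h.apply_pole, e.left_inv (by simp [h.source_eq])])
    (by simp only [hη, one_smul]; exact e.left_inv (by simp [h.source_eq])) zero_le_one
  have h2 : ∀ s, ‖(mfderiv 𝓘(ℝ, ℝ) (𝓡 d) η s (1 : ℝ) : TangentSpace (𝓡 d) (η s))‖ = ‖e p‖ := by
    intro s
    have h3 := mfderiv_comp (I := 𝓘(ℝ, ℝ)) (I' := 𝓡 d) (I'' := 𝓡 d) s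
      (hsmooth.mdifferentiable (by simp) (s • e p)) (hline s).differentiableAt.mdifferentiableAt
    have h4 : (mfderiv 𝓘(ℝ, ℝ) (𝓡 d) η s (1 : ℝ) : TangentSpace (𝓡 d) (η s))
        = (mfderiv (𝓡 d) (𝓡 d) e.symm (s • e p) (e p) : TangentSpace (𝓡 d) (e.symm (s • e p))) := by
      refine (DFunLike.congr_fun h3 (1 : ℝ)).trans ?_
      refine congrArg (mfderiv (𝓡 d) (𝓡 d) e.symm (s • e p)) ?_
      rw [mfderiv_eq_fderiv]
      exact fderiv_apply_one_eq_deriv.trans (hline s).deriv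
    rw [h4]
    refine (sq_eq_sq₀ (norm_nonneg _) (norm_nonneg _)).1 ?_
    rw [← real_inner_self_eq_norm_sq, ← metricForm_eq_inner]
    exact h.isNormalMetric.apply_line s (e p)
  have h3 : pathELength (𝓡 d) η 0 1 = ENNReal.ofReal ‖e p‖ := by
    rw [pathELength_eq_lintegral_mfderiv_Icc]
    have h4 : ∀ s, ‖(mfderiv 𝓘(ℝ, ℝ) (𝓡 d) η s (1 : ℝ) : TangentSpace (𝓡 d) (η s))‖ₑ
        = ENNReal.ofReal ‖e p‖ := fun s ↦ by rw [← ofReal_norm, h2]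
    exact (lintegral_congr h4).trans (by simp)
  rw [← IsRiemannianManifold.out (I := 𝓡 d), h3, edist_comm, edist_dist] at h1
  exact (ENNReal.ofReal_le_ofReal_iff (norm_nonneg _)).1 h1

lemma norm_le_dist (h : IsNormalChart o L e) (p : M) : ‖e p‖ ≤ dist p o := by
  refine le_of_forall_pos_le_add fun ε hε ↦ ?_
  -- `√(‖y‖² + ε²)` is a smooth substitute for `‖y‖` whose gradient has length at most one
  suffices hmain : ENNReal.ofReal (‖e p‖ - ε) ≤ edist p o by
    rw [edist_dist] at hmain
    linarith [(ENNReal.ofReal_le_ofReal_iff dist_nonneg).1 hmain]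
  rw [IsRiemannianManifold.out (I := 𝓡 d)]
  refine le_of_forall_gt fun r hr ↦ ?_
  obtain ⟨η, hη0, hη1, hη, hlen⟩ := exists_lt_of_riemannianEDist_lt hr
  refine lt_of_le_of_lt ?_ hlen
  set y : ℝ → EuclideanSpace ℝ (Fin d) := fun t ↦ e (η t) with hy
  have hsm := contMDiff_of_source_eq_univ h.mem_maximalAtlas h.source_eq
  have hyC : ContDiffOn ℝ 1 y (Icc 0 1) := contMDiffOn_iff_contDiffOn.1
    ((hsm.of_le (by norm_cast)).comp_contMDiffOn hη)
  have hpos : ∀ z : EuclideanSpace ℝ (Fin d), 0 < ‖z‖ ^ 2 + ε ^ 2 := fun z ↦ by positivity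
  set f : ℝ → ℝ := fun t ↦ √(‖y t‖ ^ 2 + ε ^ 2) with hf
  have hfC : ContDiffOn ℝ 1 f (Icc 0 1) :=
    ((hyC.norm_sq ℝ).add contDiffOn_const).sqrt fun t _ ↦ (hpos _).ne'
  have h1 := enorm_sub_le_lintegral_derivWithin_Icc_of_contDiffOn_Icc hfC zero_le_one
  have hf1 : f 1 = ε := by
    simp only [hf, hy, hη1, h.apply_pole]
    simp [Real.sqrt_sq hε.le]
  have hf0 : ‖e p‖ ≤ f 0 := by
    simp only [hf, hy, hη0]
    exact Real.le_sqrt_of_sq_le (by linarith [sq_nonneg ε])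
  refine le_trans ?_ (h1.trans ?_)
  · rw [← ofReal_norm, hf1, Real.norm_eq_abs, abs_sub_comm]
    exact ENNReal.ofReal_le_ofReal ((sub_le_sub_right hf0 ε).trans (le_abs_self _))
  · rw [pathELength_eq_lintegral_mfderivWithin_Icc]
    refine setLIntegral_mono' measurableSet_Icc fun t ht ↦ ?_
    rw [← ofReal_norm, ← ofReal_norm]
    refine ENNReal.ofReal_le_ofReal ?_
    have huniq : UniqueDiffWithinAt ℝ (Icc (0 : ℝ) 1) t := uniqueDiffOn_Icc zero_lt_one t ht
    have hyd := ((hyC t ht).differentiableWithinAt one_ne_zero).hasDerivWithinAt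
    have hfd : HasDerivWithinAt f _ (Icc 0 1) t :=
      ((hyd.norm_sq).add_const (ε ^ 2)).sqrt (hpos _).ne'
    have hy' : derivWithin y (Icc 0 1) t
        = mfderiv (𝓡 d) (𝓡 d) e (η t)
            (mfderivWithin 𝓘(ℝ, ℝ) (𝓡 d) η (Icc 0 1) t (1 : ℝ)) := by
      have h3 := mfderiv_comp_mfderivWithin (I := 𝓘(ℝ, ℝ)) (I' := 𝓡 d) (I'' := 𝓡 d) t
        (hsm.mdifferentiable (by simp) (η t)) (hη.mdifferentiableOn one_ne_zero t ht)
        huniq.uniqueMDiffWithinAt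
      refine Eq.trans ?_ (DFunLike.congr_fun h3 (1 : ℝ))
      rw [mfderivWithin_eq_fderivWithin]
      exact fderivWithin_derivWithin.symm
    rw [hfd.derivWithin huniq, hy']
    have h4 := h.abs_inner_le (η t) (mfderivWithin 𝓘(ℝ, ℝ) (𝓡 d) η (Icc 0 1) t (1 : ℝ))
    have h5 : ‖y t‖ ≤ √(‖y t‖ ^ 2 + ε ^ 2) := Real.le_sqrt_of_sq_le (by linarith [sq_nonneg ε])
    have h6 : 0 < √(‖y t‖ ^ 2 + ε ^ 2) := Real.sqrt_pos.2 (hpos _)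
    rw [Real.norm_eq_abs, mul_div_mul_left _ _ two_ne_zero, abs_div, abs_of_pos h6, div_le_iff₀ h6,
      mul_comm ‖_‖]
    exact h4.trans (mul_le_mul_of_nonneg_right h5 (norm_nonneg _))

/-- In normal coordinates the distance to the pole is the Euclidean norm. -/
lemma dist_eq_norm (h : IsNormalChart o L e) (p : M) : dist p o = ‖e p‖ :=
  (h.dist_le_norm p).antisymm (h.norm_le_dist p)

/-- The lower bound on the Hessian of `r²`, in normal coordinates. -/
lemma hessian_bound (h : IsNormalChart o L e) {c : ℝ}
    (hc : HessianGE (d := d) (fun x : M ↦ dist x o ^ 2) c) (y w : EuclideanSpace ℝ (Fin d)) :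
    c * metricForm e y w w ≤ 2 * ‖w‖ ^ 2 - 2 * inner ℝ y (christoffelMap e y w) := by
  have hf : (fun x : M ↦ dist x o ^ 2) ∘ e.symm = fun z ↦ ‖z‖ ^ 2 := by
    ext1 z
    simp only [Function.comp_apply]
    rw [h.dist_eq_norm, e.right_inv (by simp [h.target_eq])]
  have hp1 : ∀ j, pderiv j (fun z : EuclideanSpace ℝ (Fin d) ↦ ‖z‖ ^ 2) = fun z ↦ 2 * z j := by
    intro j
    ext1 z
    simp [pderiv, stdVec, fderiv_norm_sq_apply, EuclideanSpace.inner_single_right]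
  have hp2 : ∀ i j, pderiv i (fun z : EuclideanSpace ℝ (Fin d) ↦ 2 * z j) y
      = if j = i then 2 else 0 := by
    intro i j
    have h1 := (((EuclideanSpace.proj (𝕜 := ℝ) j).hasFDerivAt (x := y)).const_mul 2).fderiv
    have h2 : (fun z : EuclideanSpace ℝ (Fin d) ↦ 2 * z j)
        = fun z ↦ 2 * (EuclideanSpace.proj (𝕜 := ℝ) j : EuclideanSpace ℝ (Fin d) →L[ℝ] ℝ) z := rfl
    rw [pderiv, h2, h1]
    simp [stdVec]
  have h1 := hc e h.mem_maximalAtlas y (by simp [h.target_eq]) w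
  rw [metricForm_apply]
  refine h1.trans_eq ?_
  simp only [hessian, hf, hp1, hp2, sub_mul, Finset.sum_sub_distrib]
  congr 1
  · rw [EuclideanSpace.real_norm_sq_eq, Finset.mul_sum]
    refine Finset.sum_congr rfl fun i _ ↦ ?_
    simp [ite_mul, sq, mul_assoc]
  · simp only [PiLp.inner_apply, christoffelMap, RCLike.inner_apply, conj_trivial, Finset.mul_sum,
      Finset.sum_mul]
    rw [Finset.sum_comm_cycle]
    exact Finset.sum_congr rfl fun i _ ↦ Finset.sum_congr rfl fun j _ ↦
      Finset.sum_congr rfl fun k _ ↦ by ring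

end IsNormalChart

end Distance

end PoleScattering

theorem mainTheorem8 {d : ℕ} (hd : 2 ≤ d) {M : Type*} [MetricSpace M]
    [ChartedSpace (EuclideanSpace ℝ (Fin d)) M] [IsManifold (𝓡 d) ∞ M]
    [RiemannianBundle (fun x : M ↦ TangentSpace (𝓡 d) x)]
    [IsContMDiffRiemannianBundle (𝓡 d) ∞ (EuclideanSpace ℝ (Fin d))
      (fun x : M ↦ TangentSpace (𝓡 d) x)]
    [IsRiemannianManifold (𝓡 d) M] [ConnectedSpace M] [CompleteSpace M]
    (o : M) (ho : PoleScattering.IsPole (d := d) o)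
    (δ : ℝ) (hδ₀ : 0 < δ) (hδ₁ : δ ≤ 1)
    (hconv : PoleScattering.HessianGE (d := d) (fun x : M ↦ dist x o ^ 2) (1 + δ))
    (T : ℝ) (γ : ℝ → M) (hγ : PoleScattering.IsGeodesicOn (d := d) γ (Ioi T)) :
    ∃ ω_inf : M, Tendsto (fun t ↦ PoleScattering.dilation d o t (γ t)) atTop (𝓝 ω_inf) := by
  obtain ⟨L, e, he⟩ := ho.exists_isNormalChart
  have hode : ∀ t > T, _ := fun t ht ↦
    hγ.hasDerivAt_chart he.mem_maximalAtlas he.source_eq isOpen_Ioi ht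
  obtain ⟨z, hz⟩ := he.isNormalMetric.exists_tendsto_geodesic hδ₀ (he.hessian_bound hconv)
    (fun t ht ↦ (hode t ht).1) (fun t ht ↦ (hode t ht).2)
  refine ⟨e.symm z, ?_⟩
  simp only [he.dilation_eq]
  exact ((e.symm.continuousAt (by simp [he.target_eq])).tendsto).comp hz
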